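/- For permutations $\sigma,\theta$ in the symmetric group $S_n$ on $n$ letters let $d_S(\sigma,\theta)=n-F(\sigma\theta^{-1})$, where $F(\nu)$ is the number of fixed points of $\nu$, and let $w_k$ be the number of permutations in $S_n$ with exactly $k$ fixed points. For a nonempty set $D\subseteq S_n$ put $$f_j=\frac{\#\{(x,y)\in D^2: d_S(x,y)=j\}}{|D|^2}\quad(0\le j\le n),\qquad \rho(D)=\max_{x\in S_n}\ \min_{y\in D}\ d_S(x,y).$$ The set $D$ is called a $t$-design if $$\sum_{j=0}^n f_j\,j^i=\sum_{j=0}^n\frac{w_{n-j}}{n!}\,j^i\qquad\text{for } i=1,\dots,t,$$ and its half-strength is then $s=\lfloor (t+1)/2\rfloor$. The Charlier polynomial $C_k$ is $$C_k(x)=\sum_{i=0}^k(-1)^{k-i}\binom{k}{i}\,x(x-1)\cdots(x-i+1).$$ **Theorem.** Let $t\le n$, let $D\subseteq S_n$ be a nonempty $t$-design, and suppose that its half-strength $s=\lfloor (t+1)/2\rfloor$ satisfies $s>1$. Then $C_s$ has a largest real zero $x(s)$, and the covering radius of $D$ satisfies $$\rho(D)<n-x(s).$$ -/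

import Mathlib

namespace PermDesign

/-- `F ν`: the number of fixed points of the permutation `ν` of `n` letters. -/
def fixCount {n : ℕ} (ν : Equiv.Perm (Fin n)) : ℕ :=
  (Finset.univ.filter fun a : Fin n => ν a = a).card

/-- A permutation of `n` letters has at most `n` fixed points, so that the natural-number
subtraction in `permDist` never truncates. -/
theorem fixCount_le {n : ℕ} (ν : Equiv.Perm (Fin n)) : fixCount ν ≤ n := by
  unfold fixCount
  exact (Finset.card_filter_le _ _).trans (by simp)

/-- The metric `d_S(σ, θ) = n - F(σ θ⁻¹)` on the symmetric group. -/
def permDist {n : ℕ} (σ θ : Equiv.Perm (Fin n)) : ℕ :=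
  n - fixCount (σ * θ⁻¹)

/-- The rencontres number `w_k`: the number of permutations of `n` letters with exactly `k`
fixed points. -/
def rencontres (n k : ℕ) : ℕ :=
  (Finset.univ.filter fun ν : Equiv.Perm (Fin n) => fixCount ν = k).card

/-- The covering radius `max {min {d_S(x, y) | y ∈ Y} | x ∈ S_n}` of a nonempty set `Y` of
permutations. -/
def coveringRadius {n : ℕ} (Y : Finset (Equiv.Perm (Fin n))) (hY : Y.Nonempty) : ℕ :=
  Finset.univ.sup' Finset.univ_nonempty fun x : Equiv.Perm (Fin n) =>
    Y.inf' hY fun y => permDist x y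

/-- The frequency `f_i` of `D`: the proportion of ordered pairs of elements of `D` that are
at distance `i`. -/
noncomputable def frequency {n : ℕ} (D : Finset (Equiv.Perm (Fin n))) (i : ℕ) : ℝ :=
  (((D ×ˢ D).filter fun p => permDist p.1 p.2 = i).card : ℝ) / (D.card : ℝ) ^ 2

/-- `D` is a `t`-design: the moments of order `1, …, t` of its distance distribution are those
of the whole symmetric group (in which `w_{n - j}` permutations are at distance `j` from any
given one). -/
def IsDesign {n : ℕ} (D : Finset (Equiv.Perm (Fin n))) (t : ℕ) : Prop :=
  ∀ i : ℕ, 1 ≤ i → i ≤ t →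
    ∑ j ∈ Finset.range (n + 1), frequency D j * (j : ℝ) ^ i =
      ∑ j ∈ Finset.range (n + 1), (rencontres n (n - j) : ℝ) / (n.factorial : ℝ) * (j : ℝ) ^ i

/-- The Charlier polynomial
`C_k(x) = ∑_{i = 0}^{k} (-1)^(k - i) (k choose i) x (x - 1) ⋯ (x - i + 1)`. -/
noncomputable def charlier (k : ℕ) : Polynomial ℝ :=
  ∑ i ∈ Finset.range (k + 1),
    Polynomial.C ((-1 : ℝ) ^ (k - i) * (k.choose i : ℝ)) * descPochhammer ℝ i

/-- The largest real zero `x(k)` of `C_k`. -/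
noncomputable def largestZero (k : ℕ) : ℝ :=
  sSup {z : ℝ | (charlier k).eval z = 0}

/-- The half-strength `⌊(t + 1) / 2⌋` of a `t`-design. -/
def halfStrength (t : ℕ) : ℕ := (t + 1) / 2

end PermDesign

namespace PermDesign

open Polynomial

/-! Fix `x` and let `F` be the number of fixed points of `x * y⁻¹` as `y` runs over `D`. The design
condition only concerns pairs inside `D`, but a variance argument turns it into information seen
from every `x`: the factorial moments of `F` of order at most `t` are all 1 on average, as for the
Poisson law of mean 1 (`IsDesign.sum_descPochhammer_right`). The Charlier polynomials are orthogonal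
for such moments (`linearMap_charlier_mul_eq_zero`). Write `C_s = (X - z) q` with `z` the largest
zero. Then `C_s q = (X - z) q²` has sum 0 over `D`. If `F ≤ z` throughout, every term vanishes, so
`C_s` vanishes at a natural number, which arithmetic forbids for `s > 1`
(`eval_charlier_natCast_ne_zero`). Hence some `y` has `F > z`. -/

/-! ### Charlier polynomials: recursion and zeros. -/

/-- The operator `p(X) ↦ X * p(X - 1)`, which shifts the falling factorials. -/
noncomputable def mulShift : ℝ[X] →ₗ[ℝ] ℝ[X] :=
  LinearMap.mulLeft ℝ X ∘ₗ (aeval (X - 1 : ℝ[X])).toLinearMap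

theorem mulShift_apply (p : ℝ[X]) : mulShift p = X * p.comp (X - 1) := by
  simp [mulShift, aeval_def, comp, eval₂_eq_eval_map, algebraMap_eq]

theorem mulShift_pow_one (i : ℕ) : (mulShift ^ i) 1 = descPochhammer ℝ i := by
  induction i with
  | zero => simp
  | succ i ih => rw [pow_succ', Module.End.mul_apply, ih, mulShift_apply, descPochhammer_succ_left]

/-- Binomial theorem for `(mulShift - 1) ^ k`; this form gives the recursion at once. -/
theorem charlier_eq_pow (k : ℕ) : charlier k = ((mulShift - 1) ^ k) 1 := by
  rw [sub_eq_add_neg, (Commute.neg_right (Commute.one_right mulShift)).add_pow, LinearMap.sum_apply,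
    charlier]
  refine Finset.sum_congr rfl fun i _ => ?_
  have h : mulShift ^ i * (-1) ^ (k - i) * ((k.choose i : ℕ) : Module.End ℝ ℝ[X])
      = ((-1 : ℝ) ^ (k - i) * (k.choose i : ℝ)) • mulShift ^ i := by
    rw [show (-1 : Module.End ℝ ℝ[X]) = algebraMap ℝ _ (-1) by rw [map_neg, map_one], ← map_pow,
      ← map_natCast (algebraMap ℝ (Module.End ℝ ℝ[X])), mul_assoc, ← map_mul, ← Algebra.commutes,
      ← Algebra.smul_def]
  rw [h, LinearMap.smul_apply, mulShift_pow_one, smul_eq_C_mul]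

theorem charlier_zero : charlier 0 = 1 := by simp [charlier_eq_pow]

theorem charlier_succ (k : ℕ) :
    charlier (k + 1) = X * (charlier k).comp (X - 1) - charlier k := by
  rw [charlier_eq_pow, pow_succ', Module.End.mul_apply, ← charlier_eq_pow, LinearMap.sub_apply,
    mulShift_apply, Module.End.one_apply]

theorem charlier_monic_natDegree (k : ℕ) :
    (charlier k).Monic ∧ (charlier k).natDegree = k := by
  induction k with
  | zero => simp [charlier_zero]
  | succ k ih =>
    obtain ⟨hm, hd⟩ := ih
    have hX : (X - 1 : ℝ[X]).natDegree = 1 := by simpa using natDegree_X_sub_C (1 : ℝ)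
    have hXm : (X - 1 : ℝ[X]).Monic := by simpa using monic_X_sub_C (1 : ℝ)
    have hc : ((charlier k).comp (X - 1)).Monic := hm.comp hXm (by rw [hX]; exact one_ne_zero)
    have hm' : (X * (charlier k).comp (X - 1)).Monic := monic_X.mul hc
    have hd' : (X * (charlier k).comp (X - 1)).natDegree = k + 1 := by
      rw [monic_X.natDegree_mul hc, natDegree_X, natDegree_comp, hd, hX]; ring
    have hlt : (charlier k).degree < (X * (charlier k).comp (X - 1)).degree :=
      degree_lt_degree (by rw [hd, hd']; exact Nat.lt_succ_self k)
    rw [charlier_succ]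
    exact ⟨hm'.sub_of_left hlt,
      by rw [natDegree_sub_eq_left_of_natDegree_lt (by rw [hd, hd']; exact Nat.lt_succ_self k), hd']⟩

theorem charlier_ne_zero (k : ℕ) : charlier k ≠ 0 := (charlier_monic_natDegree k).1.ne_zero

theorem eval_charlier_succ (k : ℕ) (x : ℝ) :
    (charlier (k + 1)).eval x = x * (charlier k).eval (x - 1) - (charlier k).eval x := by
  simp [charlier_succ]

theorem eval_charlier_zero (k : ℕ) : (charlier k).eval 0 = (-1) ^ k := by
  induction k with
  | zero => simp [charlier_zero]
  | succ k ih => rw [eval_charlier_succ, ih, pow_succ]; ring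

theorem eval_charlier_one (k : ℕ) : (charlier k).eval 1 = (-1) ^ k * (1 - k) := by
  induction k with
  | zero => simp [charlier_zero]
  | succ k ih =>
    rw [eval_charlier_succ, ih, sub_self, eval_charlier_zero, pow_succ]; push_cast; ring

/-- Modulo `m` the recursion reduces to a change of sign. An integer zero must therefore divide 1.
-/
theorem exists_int_eval_charlier (k : ℕ) :
    ∃ c : ℤ → ℤ, (∀ m : ℤ, (charlier k).eval (m : ℝ) = c m) ∧ ∀ m : ℤ, m ∣ c m - (-1) ^ k := by
  induction k with
  | zero => exact ⟨fun _ => 1, by simp [charlier_zero], by simp⟩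
  | succ k ih =>
    obtain ⟨c, hc, hdvd⟩ := ih
    refine ⟨fun m => m * c (m - 1) - c m, fun m => ?_, fun m => ?_⟩
    · rw [eval_charlier_succ, hc m]
      have := hc (m - 1)
      push_cast at this ⊢
      rw [this]
    · have : m * c (m - 1) - c m - (-1) ^ (k + 1) = m * c (m - 1) - (c m - (-1) ^ k) := by ring
      rw [this]
      exact (Dvd.intro _ rfl).sub (hdvd m)

/-- A Charlier polynomial of degree at least two has no zero among the natural numbers. -/
theorem eval_charlier_natCast_ne_zero {k : ℕ} (hk : 1 < k) (m : ℕ) :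
    (charlier k).eval (m : ℝ) ≠ 0 := by
  intro h
  obtain ⟨c, hc, hdvd⟩ := exists_int_eval_charlier k
  have h0 : c m = 0 := by
    have := hc m
    rw [Int.cast_natCast, h] at this
    exact_mod_cast this.symm
  have h1 : IsUnit (m : ℤ) := by
    have := hdvd m
    rw [h0, zero_sub, dvd_neg] at this
    exact isUnit_of_dvd_unit this ((isUnit_one.neg).pow k)
  have hm : m = 1 := by simpa using Int.isUnit_iff_natAbs_eq.1 h1
  rw [hm, Nat.cast_one, eval_charlier_one] at h
  have hk' : (1 : ℝ) < k := by exact_mod_cast hk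
  rcases mul_eq_zero.1 h with h | h
  · exact pow_ne_zero k (by norm_num) h
  · linarith

/-- The values at 0 and 1 have opposite signs. -/
theorem exists_eval_charlier_eq_zero {k : ℕ} (hk : 1 < k) : ∃ z : ℝ, (charlier k).eval z = 0 := by
  have hk' : (1 : ℝ) < k := by exact_mod_cast hk
  have hc : ContinuousOn (fun x : ℝ => (charlier k).eval x) (Set.uIcc 0 1) :=
    (charlier k).continuous.continuousOn
  have hmem : (0 : ℝ) ∈ Set.uIcc ((charlier k).eval 0) ((charlier k).eval 1) := by
    rw [eval_charlier_zero, eval_charlier_one, Set.mem_uIcc]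
    rcases neg_one_pow_eq_or ℝ k with h | h <;> rw [h]
    · right; constructor <;> linarith
    · left; constructor <;> linarith
  obtain ⟨z, -, hz⟩ := intermediate_value_uIcc hc hmem
  exact ⟨z, hz⟩

theorem isGreatest_largestZero {k : ℕ} (hk : 1 < k) :
    IsGreatest {z : ℝ | (charlier k).eval z = 0} (largestZero k) := by
  have hfin : {z : ℝ | (charlier k).eval z = 0}.Finite :=
    ((charlier k).rootSet_finite ℝ).subset fun z hz => by
      rw [mem_rootSet]; exact ⟨charlier_ne_zero k, by simpa using hz⟩
  exact ⟨Set.Nonempty.csSup_mem (exists_eval_charlier_eq_zero hk) hfin,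
    fun z hz => le_csSup hfin.bddAbove hz⟩

/-! ### Orthogonality for Poisson-like functionals. -/

theorem linearMap_eq_of_descPochhammer {L L' : ℝ[X] →ₗ[ℝ] ℝ} {t : ℕ}
    (h : ∀ i < t, L (descPochhammer ℝ i) = L' (descPochhammer ℝ i))
    {p : ℝ[X]} (hp : p.degree < t) : L p = L' p := by
  induction t generalizing p with
  | zero => simp_all
  | succ t ih =>
    have hq : (p - p.coeff t • descPochhammer ℝ t).degree < t := by
      rw [degree_lt_iff_coeff_zero] at hp ⊢
      intro m hm
      rcases hm.eq_or_lt with rfl | hm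
      · have := monic_descPochhammer ℝ t
        rw [Monic, leadingCoeff, descPochhammer_natDegree] at this
        simp [this]
      · rw [coeff_sub, hp m hm, coeff_smul,
          coeff_eq_zero_of_natDegree_lt (p := descPochhammer ℝ t) (by rwa [descPochhammer_natDegree]),
          smul_zero, sub_zero]
    have := ih (fun i hi => h i (by omega)) hq
    simpa [h t (Nat.lt_succ_self t)] using this

/-- The orthogonality of the Charlier polynomials for a functional that takes the first `t + 1`
falling factorials to a common value, as the Poisson distribution does. -/
theorem linearMap_charlier_mul_eq_zero {L : ℝ[X] →ₗ[ℝ] ℝ} {t : ℕ} {a : ℝ}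
    (hL : ∀ i ≤ t, L (descPochhammer ℝ i) = a) {k : ℕ} {q : ℝ[X]} (hq : q.degree < k)
    (hkt : k + q.natDegree ≤ t) : L (charlier k * q) = 0 := by
  -- The Poisson identity `E[X p(X - 1)] = E[p(X)]`, checked on falling factorials.
  have key : ∀ p : ℝ[X], p.degree < t → L (X * p.comp (X - 1)) = L p := fun p hp => by
    rw [← mulShift_apply, ← LinearMap.comp_apply]
    refine linearMap_eq_of_descPochhammer (fun i hi => ?_) hp
    rw [LinearMap.comp_apply, mulShift_apply, ← descPochhammer_succ_left, hL i hi.le, hL (i + 1) hi]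
  induction k generalizing q with
  | zero =>
    have : q = 0 := by simpa using hq
    simp [this]
  | succ k ih =>
    have hdeg : (q.comp (X + 1)).natDegree = q.natDegree := by
      have : (X + 1 : ℝ[X]).natDegree = 1 := by simpa using natDegree_X_add_C (1 : ℝ)
      rw [natDegree_comp, this, mul_one]
    have hback : (q.comp (X + 1)).comp (X - 1) = q := by simp [comp_assoc]
    have h1 : X * (charlier k).comp (X - 1) * q
        = X * (charlier k * q.comp (X + 1)).comp (X - 1) := by
      rw [mul_comp, hback, mul_assoc]
    have h2 : L (X * (charlier k).comp (X - 1) * q) = L (charlier k * q.comp (X + 1)) := by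
      rw [h1]
      refine key _ ((degree_le_natDegree.trans_lt (Nat.cast_lt.2 ?_)))
      refine natDegree_mul_le.trans_lt ?_
      rw [hdeg, (charlier_monic_natDegree k).2]
      omega
    -- Summation by parts: lowering the Charlier index replaces `q` by its forward difference, of
    -- smaller degree.
    have h3 : L (charlier (k + 1) * q) = L (charlier k * (q.comp (X + 1) - q)) := by
      rw [charlier_succ, sub_mul, map_sub, h2, ← map_sub, mul_sub]
    rw [h3]
    by_cases hq0 : q = 0
    · simp [hq0]
    have hlt : (q.comp (X + 1) - q).degree < q.degree := by
      have ht : q.comp (X + 1) = taylor 1 q := by simp [taylor_apply]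
      have hd : (taylor 1 q).degree = q.degree := degree_taylor q 1
      rw [ht]
      refine degree_sub_lt_right hd hq0 ?_
      rw [leadingCoeff_taylor]
    refine ih (hlt.trans_le ?_) ?_
    · rw [degree_eq_natDegree hq0] at hq ⊢
      exact Nat.cast_le.2 (Nat.lt_succ_iff.1 (Nat.cast_lt.1 hq))
    · have := natDegree_le_natDegree hlt.le
      omega

/-! ### Factorial moments of fixed points. -/

theorem card_filter_smul_embedding_eq {n : ℕ} (ν : Equiv.Perm (Fin n)) (i : ℕ) :
    ((Finset.univ.filter fun c : Fin i ↪ Fin n => ν • c = c).card : ℝ)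
      = (descPochhammer ℝ i).eval (fixCount ν : ℝ) := by
  rw [descPochhammer_eval_eq_descFactorial]
  have e : {c : Fin i ↪ Fin n // ν • c = c} ≃ (Fin i ↪ {a : Fin n // ν a = a}) :=
    { toFun := fun c => ⟨fun j => ⟨c.1 j, DFunLike.congr_fun c.2 j⟩,
        fun j j' h => c.1.injective (Subtype.ext_iff.1 h)⟩
      invFun := fun c => ⟨c.trans (Function.Embedding.subtype _), by
        ext j; exact congrArg Fin.val (c j).2⟩
      left_inv := fun c => rfl
      right_inv := fun c => rfl }
  have := Fintype.card_congr e
  rw [Fintype.card_embedding_eq, Fintype.card_fin, Fintype.card_subtype,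
    Fintype.card_subtype] at this
  rw [this]
  rfl

/-- Burnside's lemma for the transitive action on injective `i`-tuples. -/
theorem sum_eval_descPochhammer_fixCount {n i : ℕ} (hi : i ≤ n) :
    ∑ ν : Equiv.Perm (Fin n), (descPochhammer ℝ i).eval (fixCount ν : ℝ) = n.factorial := by
  classical
  have hpre : MulAction.IsPretransitive (Equiv.Perm (Fin n)) (Fin i ↪ Fin n) :=
    Equiv.Perm.isMultiplyPretransitive (Fin n) i
  have hne : Nonempty (Fin i ↪ Fin n) := ⟨Fin.castLEEmb hi⟩
  have hB := MulAction.sum_card_fixedBy_eq_card_orbits_mul_card_group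
    (Equiv.Perm (Fin n)) (Fin i ↪ Fin n)
  have h1 : Fintype.card
      (Quotient (MulAction.orbitRel (Equiv.Perm (Fin n)) (Fin i ↪ Fin n))) = 1 := by
    rw [Fintype.card_eq_one_iff_nonempty_unique]
    have := (MulAction.pretransitive_iff_subsingleton_quotient
      (Equiv.Perm (Fin n)) (Fin i ↪ Fin n)).1 hpre
    exact ⟨⟨⟨⟦Fin.castLEEmb hi⟧⟩, fun _ => Subsingleton.elim _ _⟩⟩
  rw [h1, one_mul, Fintype.card_perm, Fintype.card_fin] at hB
  rw [← hB, Nat.cast_sum]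
  refine Finset.sum_congr rfl fun ν _ => ?_
  rw [← card_filter_smul_embedding_eq]
  congr 1
  rw [Fintype.card_of_subtype]
  intro c
  simp [MulAction.mem_fixedBy]

/-! ### Moments of designs. -/

theorem permDist_le {n : ℕ} (x y : Equiv.Perm (Fin n)) : permDist x y ≤ n := Nat.sub_le _ _

theorem cast_permDist {n : ℕ} (x y : Equiv.Perm (Fin n)) :
    (permDist x y : ℝ) = n - fixCount (x * y⁻¹) := by
  rw [permDist, Nat.cast_sub (fixCount_le _)]

theorem sum_frequency_mul {n : ℕ} (D : Finset (Equiv.Perm (Fin n))) (g : ℕ → ℝ) :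
    ∑ j ∈ Finset.range (n + 1), frequency D j * g j
      = (∑ p ∈ D ×ˢ D, g (permDist p.1 p.2)) / (D.card : ℝ) ^ 2 := by
  have hmaps : ∀ p ∈ D ×ˢ D, permDist p.1 p.2 ∈ Finset.range (n + 1) := fun p _ =>
    Finset.mem_range_succ_iff.2 (permDist_le _ _)
  rw [← Finset.sum_fiberwise_of_maps_to hmaps, Finset.sum_div]
  refine Finset.sum_congr rfl fun j _ => ?_
  rw [Finset.sum_congr rfl fun p hp => by rw [(Finset.mem_filter.1 hp).2], Finset.sum_const,
    nsmul_eq_mul, frequency, div_mul_eq_mul_div]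

theorem sum_rencontres_mul {n : ℕ} (g : ℕ → ℝ) :
    ∑ j ∈ Finset.range (n + 1), (rencontres n (n - j) : ℝ) / (n.factorial : ℝ) * g j
      = (∑ ν : Equiv.Perm (Fin n), g (n - fixCount ν)) / (n.factorial : ℝ) := by
  have hmaps : ∀ ν ∈ (Finset.univ : Finset (Equiv.Perm (Fin n))),
      n - fixCount ν ∈ Finset.range (n + 1) := fun ν _ =>
    Finset.mem_range_succ_iff.2 (Nat.sub_le _ _)
  rw [← Finset.sum_fiberwise_of_maps_to hmaps, Finset.sum_div]
  refine Finset.sum_congr rfl fun j hj => ?_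
  rw [Finset.sum_congr rfl fun p hp => by rw [(Finset.mem_filter.1 hp).2], Finset.sum_const,
    nsmul_eq_mul, rencontres, div_mul_eq_mul_div]
  congr 4
  ext ν
  have := fixCount_le ν
  have := Finset.mem_range_succ_iff.1 hj
  simp only [Finset.mem_filter, Finset.mem_univ, true_and]
  omega

theorem IsDesign.sum_eval_eq {n t : ℕ} {D : Finset (Equiv.Perm (Fin n))} (hD : D.Nonempty)
    (h : IsDesign D t) {p : ℝ[X]} (hp : p.natDegree ≤ t) :
    (∑ q ∈ D ×ˢ D, p.eval (permDist q.1 q.2 : ℝ)) / (D.card : ℝ) ^ 2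
      = (∑ ν : Equiv.Perm (Fin n), p.eval ((n - fixCount ν : ℕ) : ℝ)) / (n.factorial : ℝ) := by
  have hD0 : (D.card : ℝ) ≠ 0 := by exact_mod_cast hD.card_pos.ne'
  have hpow : ∀ i ≤ t, (∑ q ∈ D ×ˢ D, (permDist q.1 q.2 : ℝ) ^ i) / (D.card : ℝ) ^ 2
      = (∑ ν : Equiv.Perm (Fin n), ((n - fixCount ν : ℕ) : ℝ) ^ i) / (n.factorial : ℝ) := by
    intro i hi
    -- The moment of order 0, absent from the definition of a design, is 1 on both sides.
    rcases Nat.eq_zero_or_pos i with rfl | hi0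
    · have hn : (n.factorial : ℝ) ≠ 0 := by exact_mod_cast n.factorial_ne_zero
      have hD2 : (D.card : ℝ) * D.card ≠ 0 := mul_ne_zero hD0 hD0
      simp [Fintype.card_perm, Finset.card_product, sq, div_self hn, div_self hD2]
    · have := h i hi0 hi
      rwa [sum_frequency_mul D fun j => (j : ℝ) ^ i,
        sum_rencontres_mul fun j => (j : ℝ) ^ i] at this
  simp only [eval_eq_sum_range' (Nat.lt_succ_of_le hp)]
  rw [Finset.sum_comm, Finset.sum_comm (s := Finset.univ), Finset.sum_div, Finset.sum_div]
  refine Finset.sum_congr rfl fun i hi => ?_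
  rw [← Finset.mul_sum, ← Finset.mul_sum, mul_div_assoc, mul_div_assoc,
    hpow i (Finset.mem_range_succ_iff.1 hi)]

theorem IsDesign.sum_descPochhammer {n t : ℕ} {D : Finset (Equiv.Perm (Fin n))} (hD : D.Nonempty)
    (h : IsDesign D t) {i : ℕ} (hit : i ≤ t) (hin : i ≤ n) :
    ∑ q ∈ D ×ˢ D, (descPochhammer ℝ i).eval (fixCount (q.1 * q.2⁻¹) : ℝ)
      = (D.card : ℝ) ^ 2 := by
  have hD0 : (D.card : ℝ) ≠ 0 := by exact_mod_cast hD.card_pos.ne'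
  have hn : (n.factorial : ℝ) ≠ 0 := by exact_mod_cast n.factorial_ne_zero
  have hdeg : ((descPochhammer ℝ i).comp (C (n : ℝ) - X)).natDegree ≤ t := by
    refine natDegree_comp_le.trans ?_
    have : (C (n : ℝ) - X).natDegree ≤ 1 := by compute_degree
    rw [descPochhammer_natDegree]
    nlinarith
  have := h.sum_eval_eq hD hdeg
  simp only [eval_comp, eval_sub, eval_C, eval_X, cast_permDist, Nat.cast_sub (fixCount_le _),
    sub_sub_cancel, sum_eval_descPochhammer_fixCount hin, div_self hn] at this
  rwa [div_eq_one_iff_eq (pow_ne_zero 2 hD0)] at this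

/-- Seen from any permutation, not only from its own elements, a `t`-design has the factorial
moments of the symmetric group: the number of its elements with prescribed values at `i ≤ t`
places does not depend on these values. -/
theorem IsDesign.sum_descPochhammer_right {n t : ℕ} {D : Finset (Equiv.Perm (Fin n))}
    (hD : D.Nonempty) (h : IsDesign D t) {i : ℕ} (hit : i ≤ t) (hin : i ≤ n)
    (x : Equiv.Perm (Fin n)) :
    ∑ y ∈ D, (descPochhammer ℝ i).eval (fixCount (x * y⁻¹) : ℝ) = D.card := by
  have hne : Nonempty (Fin i ↪ Fin n) := ⟨Fin.castLEEmb hin⟩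
  set A : ℝ := (Fintype.card (Fin i ↪ Fin n) : ℝ) with hA
  have hA0 : A ≠ 0 := by rw [hA]; exact_mod_cast Fintype.card_ne_zero
  let N : (Fin i ↪ Fin n) → (Fin i ↪ Fin n) → ℝ :=
    fun c b => ∑ y ∈ D, if y⁻¹ • c = b then 1 else 0
  have hfix : ∀ x y : Equiv.Perm (Fin n), (descPochhammer ℝ i).eval (fixCount (x * y⁻¹) : ℝ)
      = ∑ c : Fin i ↪ Fin n, if y⁻¹ • c = x⁻¹ • c then 1 else 0 := by
    intro x y
    rw [← card_filter_smul_embedding_eq, Finset.sum_boole]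
    congr 2
    ext c
    simp only [Finset.mem_filter, Finset.mem_univ, true_and]
    rw [mul_smul, eq_inv_smul_iff]
  have hrow : ∀ x : Equiv.Perm (Fin n),
      ∑ y ∈ D, (descPochhammer ℝ i).eval (fixCount (x * y⁻¹) : ℝ) = ∑ c, N c (x⁻¹ • c) := by
    intro x
    simp only [hfix, N]
    exact Finset.sum_comm
  have hsum : ∀ c, ∑ b, N c b = D.card := by
    intro c
    simp only [N]
    rw [Finset.sum_comm]
    simp
  -- `N c b` counts the `y` in `D` sending `b` to `c`, so its squares count pairs agreeing on a
  -- tuple. This is the least value allowed by the row sums, which forces `N` to be constant.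
  have hsq : ∑ c, ∑ b, N c b ^ 2 = (D.card : ℝ) ^ 2 := by
    rw [← h.sum_descPochhammer hD hit hin, Finset.sum_product]
    simp only [hrow]
    rw [Finset.sum_comm (s := D)]
    refine Finset.sum_congr rfl fun c _ => ?_
    have : ∀ b, N c b ^ 2 = ∑ x ∈ D, if x⁻¹ • c = b then N c b else 0 := by
      intro b
      rw [sq]
      nth_rewrite 1 [show N c b = ∑ y ∈ D, if y⁻¹ • c = b then 1 else 0 from rfl]
      rw [Finset.sum_mul]
      simp only [ite_mul, one_mul, zero_mul]
    simp only [this]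
    rw [Finset.sum_comm]
    simp
  have hvar : ∑ c, ∑ b, (N c b - D.card / A) ^ 2 = 0 := by
    have : ∀ c b, (N c b - D.card / A) ^ 2
        = N c b ^ 2 - 2 * (D.card / A) * N c b + (D.card / A) ^ 2 := fun c b => by ring
    simp only [this, Finset.sum_add_distrib, Finset.sum_sub_distrib, ← Finset.mul_sum, hsum, hsq,
      Finset.sum_const, Finset.card_univ, nsmul_eq_mul, ← hA]
    field_simp
    ring
  have hconst : ∀ c b, N c b = D.card / A := by
    intro c b
    have h1 := (Finset.sum_eq_zero_iff_of_nonneg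
      (fun c _ => Finset.sum_nonneg fun b _ => sq_nonneg (N c b - D.card / A))).1 hvar c (Finset.mem_univ c)
    have h2 := (Finset.sum_eq_zero_iff_of_nonneg
      (fun b _ => sq_nonneg (N c b - D.card / A))).1 h1 b (Finset.mem_univ b)
    exact sub_eq_zero.1 (pow_eq_zero_iff two_ne_zero |>.1 h2)
  rw [hrow]
  simp only [hconst, Finset.sum_const, Finset.card_univ, nsmul_eq_mul, ← hA]
  field_simp

/-! ### The covering radius bound. -/

theorem IsDesign.exists_largestZero_lt_fixCount {n t : ℕ} (htn : t ≤ n)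
    {D : Finset (Equiv.Perm (Fin n))} (hD : D.Nonempty) (h : IsDesign D t)
    (hs : 1 < halfStrength t) (x : Equiv.Perm (Fin n)) :
    ∃ y ∈ D, largestZero (halfStrength t) < fixCount (x * y⁻¹) := by
  by_contra! hle
  set s := halfStrength t with hsdef
  -- That is, `C_s q` has degree `2s - 1 ≤ t`.
  have hst : 2 * s ≤ t + 1 := by rw [hsdef, halfStrength]; omega
  set z := largestZero s with hz
  let L : ℝ[X] →ₗ[ℝ] ℝ := ∑ y ∈ D, leval (fixCount (x * y⁻¹) : ℝ)
  have hLapp : ∀ p, L p = ∑ y ∈ D, p.eval (fixCount (x * y⁻¹) : ℝ) := fun p => by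
    simp [L, LinearMap.sum_apply]
  have hL : ∀ i ≤ t, L (descPochhammer ℝ i) = D.card := fun i hi => by
    rw [hLapp, h.sum_descPochhammer_right hD hi (hi.trans htn)]
  obtain ⟨q, hq⟩ := dvd_iff_isRoot.2 (show (charlier s).IsRoot z from (isGreatest_largestZero hs).1)
  have hq0 : q ≠ 0 := by
    rintro rfl
    exact charlier_ne_zero s (by rw [hq, mul_zero])
  have hqd : q.natDegree + 1 = s := by
    have := (charlier_monic_natDegree s).2
    rw [hq, natDegree_mul (X_sub_C_ne_zero z) hq0, natDegree_X_sub_C] at this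
    omega
  have hzero : L (charlier s * q) = 0 :=
    linearMap_charlier_mul_eq_zero hL
      (degree_le_natDegree.trans_lt (Nat.cast_lt.2 (by omega))) (by omega)
  have hnonpos : ∀ y ∈ D, (charlier s * q).eval (fixCount (x * y⁻¹) : ℝ) ≤ 0 := by
    intro y hy
    have := mul_nonneg (sub_nonneg.2 (hle y hy)) (sq_nonneg (q.eval (fixCount (x * y⁻¹) : ℝ)))
    rw [hq]
    simp only [eval_mul, eval_sub, eval_X, eval_C]
    linarith
  rw [hLapp] at hzero
  obtain ⟨y, hy⟩ := hD
  have h0 := (Finset.sum_eq_zero_iff_of_nonpos hnonpos).1 hzero y hy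
  rw [eval_mul] at h0
  have hne := eval_charlier_natCast_ne_zero hs (fixCount (x * y⁻¹))
  rcases mul_eq_zero.1 h0 with h0 | h0
  · exact hne h0
  · exact hne (by rw [hq, eval_mul, h0, mul_zero])

end PermDesign

/-- The first conjunct says that `x(s)` really is the largest zero of `C_s` (in particular, that
one exists). -/
theorem mainTheorem1 (n t : ℕ) (htn : t ≤ n)
    (D : Finset (Equiv.Perm (Fin n))) (hD : D.Nonempty)
    (hdesign : PermDesign.IsDesign D t)
    (hs : 1 < PermDesign.halfStrength t) :
    IsGreatest {z : ℝ | (PermDesign.charlier (PermDesign.halfStrength t)).eval z = 0}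
        (PermDesign.largestZero (PermDesign.halfStrength t)) ∧
      (PermDesign.coveringRadius D hD : ℝ) <
        (n : ℝ) - PermDesign.largestZero (PermDesign.halfStrength t) := by
  refine ⟨PermDesign.isGreatest_largestZero hs, ?_⟩
  obtain ⟨x, -, hx⟩ := Finset.exists_mem_eq_sup' Finset.univ_nonempty
    fun x : Equiv.Perm (Fin n) => D.inf' hD fun y => PermDesign.permDist x y
  obtain ⟨y, hy, hlt⟩ := hdesign.exists_largestZero_lt_fixCount htn hD hs x
  have hle : PermDesign.coveringRadius D hD ≤ PermDesign.permDist x y := by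
    rw [PermDesign.coveringRadius, hx]
    exact Finset.inf'_le _ hy
  have hle' : (PermDesign.coveringRadius D hD : ℝ) ≤ PermDesign.permDist x y := by
    exact_mod_cast hle
  rw [PermDesign.cast_permDist] at hle'
  linarith
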